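/- A signed hypergraph $H=(V,S)$ consists of a finite set $V$ of nodes and a finite set $S$ of signed edges; a signed edge $s$ is a set of at least two nodes together with a sign $\eta_s(v)\in\{-1,+1\}$ for each of its nodes $v$ (no two elements of $S$ have both the same node set and the same signs). We assume $S\neq\emptyset$. The rank $r$ of $H$ is the maximum of $|s|$ over $s\in S$. The underlying hypergraph of $H$ is obtained by ignoring signs and identifying edges with the same node set. For a node $v$, $H-v$ has node set $V\setminus\{v\}$ and signed edges the nonempty restrictions $s-v$ of the $s\in S$ to $V\setminus\{v\}$ (equal ones are identified, and edges with one node may occur); removal of a node from a hypergraph is defined in the same way. A node $v$ of a hypergraph is a $\beta$-leaf if the edges containing $v$ are totally ordered by inclusion, and $v_1,\dots,v_t$ is a sequence of $\beta$-leaves of $G$ if $v_i$ is a $\beta$-leaf of $G-v_1-\dots-v_{i-1}$ for each $i$. The pseudo-Boolean polytope $\mathrm{PBP}(H)$ is the convex hull of the points $z\in\{0,1\}^{V\cup S}$ with $z_s=\prod_{v\in s}\sigma_s(z_v)$ for all $s\in S$, where $\sigma_s(z_v)=z_v$ if $\eta_s(v)=+1$ and $\sigma_s(z_v)=1-z_v$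 if $\eta_s(v)=-1$; the same definition is used for $H-v_1-\dots-v_t$. An extended formulation of a polytope is a finite system of linear inequalities, possibly in further auxiliary variables, whose solution set projects onto the polytope. **Theorem.** Let $H=(V,S)$ be a signed hypergraph of rank $r$ with $S\ne\emptyset$, and let $v_1,\dots,v_t$, $t\ge 1$, be a sequence of $\beta$-leaves of the underlying hypergraph of $H$. Then there is a system $Q$ of at most $4rt(2|S|+1)$ linear inequalities in which at most $2rt(2|S|+1)$ variables occur, with all coefficients and right-hand side constants in $\{0,1,-1\}$, such that for every description (in the original space or extended) $D$ of $\mathrm{PBP}(H-v_1-\dots-v_t)$, the systems $Q$ and $D$ together form an extended formulation of $\mathrm{PBP}(H)$. Here the variables of nodes and signed edges common to several of the signed hypergraphs are identified, and the auxiliary variables of $D$ are chosen different from the variables of $Q$ and of $\mathrm{PBP}(H)$. -/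

import Mathlib

/-! ## Hypergraphs: removal of a node and beta-leaves -/

/-- The hypergraph `G - v`: the nodes are those of `G` other than `v`, the edges are the nonempty
sets among the `e - v`, for `e` an edge of `G`. -/
def Hypergraph.removeNode {α : Type*} (G : Hypergraph α) (v : α) : Hypergraph α where
  vertexSet := G.vertexSet \ {v}
  edgeSet := {f | f.Nonempty ∧ ∃ e ∈ G.edgeSet, f = e \ {v}}
  subset_vertexSet_of_mem_edgeSet' := by
    rintro f ⟨-, e, he, rfl⟩
    exact Set.sdiff_subset_sdiff_left (G.subset_vertexSet_of_mem_edgeSet' he)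

/-- A node `v` is a beta-leaf if the edges containing `v` are totally ordered by inclusion. -/
def Hypergraph.IsBetaLeaf {α : Type*} (G : Hypergraph α) (v : α) : Prop :=
  v ∈ G.vertexSet ∧ IsChain (· ⊆ ·) {e | e ∈ G.edgeSet ∧ v ∈ e}

/-- `v₁, …, v_t` is a sequence of beta-leaves: each `v_i` is a beta-leaf of `G - v₁ - ⋯ - v_{i-1}`.
(The nodes are then distinct, since `v_i` is a node of `G - v₁ - ⋯ - v_{i-1}`.) -/
def Hypergraph.IsBetaLeafSeq {α : Type*} : Hypergraph α → List α → Prop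
  | _, [] => True
  | G, v :: vs => G.IsBetaLeaf v ∧ Hypergraph.IsBetaLeafSeq (G.removeNode v) vs

/-! ## Signed hypergraphs -/

/-- A signed edge: a finite set of nodes, with a sign `-1` or `+1` for each of its nodes. -/
structure SignedEdge (α : Type*) where
  edge : Finset α
  sign : edge → ℤˣ

namespace SignedEdge

variable {α : Type*}

open Classical in
/-- The signed edge `s - v`, with the restricted signs (it is `s` itself if `v ∉ s`). -/
noncomputable def remove (s : SignedEdge α) (v : α) : SignedEdge α where
  edge := s.edge.erase v
  sign := fun u => s.sign ⟨u.1, Finset.mem_of_mem_erase u.2⟩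

/-- `σ_s(x)` at the node `v ∈ s`: it is `x` if `v` has sign `+1` in `s`, and `1 - x` if it has
sign `-1`. -/
def sigma (s : SignedEdge α) (v : s.edge) (x : ℝ) : ℝ :=
  if s.sign v = 1 then x else 1 - x

end SignedEdge

/-- A signed hypergraph `(V, S)`: a finite set of nodes and a finite set of nonempty signed edges on
these nodes (parallel signed edges may occur, identical ones cannot). Signed edges with a single node
are allowed here, since the removal of a node can create them. -/
structure SignedHypergraph (α : Type*) where
  V : Finset α
  S : Finset (SignedEdge α)
  edge_subset : ∀ s ∈ S, s.edge ⊆ V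
  edge_nonempty : ∀ s ∈ S, s.edge.Nonempty

namespace SignedHypergraph

variable {α : Type*}

/-- The underlying hypergraph: signs are ignored and parallel edges are identified. -/
def underlying (H : SignedHypergraph α) : Hypergraph α where
  vertexSet := {v | v ∈ H.V}
  edgeSet := {e | ∃ s ∈ H.S, e = {v | v ∈ s.edge}}
  subset_vertexSet_of_mem_edgeSet' := by
    rintro e ⟨s, hs, rfl⟩ v hv
    exact H.edge_subset s hs hv

/-- The rank: the largest cardinality of an edge. -/
def rank (H : SignedHypergraph α) : ℕ := H.S.sup fun s => s.edge.card

open Classical in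
/-- The signed hypergraph `H - v`: its signed edges are the nonempty `s - v`, for `s ∈ S`. -/
noncomputable def removeNode (H : SignedHypergraph α) (v : α) : SignedHypergraph α where
  V := H.V.erase v
  S := (H.S.image fun s => s.remove v).filter fun s => 1 ≤ s.edge.card
  edge_subset := by
    intro s hs
    obtain ⟨s', hs', rfl⟩ := Finset.mem_image.1 (Finset.mem_filter.1 hs).1
    exact Finset.erase_subset_erase v (H.edge_subset s' hs')
  edge_nonempty := by
    intro s hs
    exact Finset.card_pos.1 (Finset.mem_filter.1 hs).2

/-- `H - v₁ - ⋯ - v_t`. -/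
noncomputable def removeNodes (H : SignedHypergraph α) (vs : List α) : SignedHypergraph α :=
  vs.foldl removeNode H

/-- The pseudo-Boolean set, in the space `ℝ^(V ∪ S)`: the binary points with
`z_s = ∏_{v ∈ s} σ_s(z_v)` for every signed edge `s`. -/
def pbs (H : SignedHypergraph α) : Set (H.V ⊕ H.S → ℝ) :=
  {z | (∀ i, z i = 0 ∨ z i = 1) ∧
    ∀ s : H.S, z (Sum.inr s) =
      ∏ v : s.1.edge, s.1.sigma v (z (Sum.inl ⟨v.1, H.edge_subset s.1 s.2 v.2⟩))}

/-- The pseudo-Boolean polytope. -/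
def pbp (H : SignedHypergraph α) : Set (H.V ⊕ H.S → ℝ) := convexHull ℝ H.pbs

end SignedHypergraph

/-! ## Systems of linear inequalities and extended formulations -/

/-- A finite system of linear inequalities, in variables named by `X`. The pair `(a, b)` stands for
the inequality `∑ x, a x * y x ≤ b` in the unknowns `y x`. (An equality counts as two
inequalities.) -/
structure LinearSystem (X : Type*) where
  ineqs : Finset ((X →₀ ℝ) × ℝ)

namespace LinearSystem

variable {X I : Type*}

/-- The solutions of the system. -/
def solutions (Q : LinearSystem X) : Set (X → ℝ) :=
  {y | ∀ c ∈ Q.ineqs, (c.1.sum fun x a => a * y x) ≤ c.2}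

open Classical in
/-- The variables of the system: those with a nonzero coefficient in one of its inequalities. -/
noncomputable def vars (Q : LinearSystem X) : Finset X := Q.ineqs.biUnion fun c => c.1.support

open Classical in
/-- Two systems taken together; variables with the same name are the same variable. -/
noncomputable def juxtapose (Q D : LinearSystem X) : LinearSystem X := ⟨Q.ineqs ∪ D.ineqs⟩

/-- All coefficients and right-hand side constants are `0`, `1` or `-1`. -/
def HasSignData (Q : LinearSystem X) : Prop :=
  ∀ c ∈ Q.ineqs, (∀ x, c.1 x = 0 ∨ c.1 x = 1 ∨ c.1 x = -1) ∧ (c.2 = 0 ∨ c.2 = 1 ∨ c.2 = -1)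

/-- `Q` is an extended formulation of `P ⊆ ℝ^I`, where the coordinate `i` is the variable `name i`:
the set `P` is the projection of the solution set of `Q` to the coordinates `I`. The variables of `Q`
that do not name a coordinate are the auxiliary ones; if there are none, `Q` is a description of `P`
in its own space. -/
def IsExtendedFormulation (Q : LinearSystem X) (name : I → X) (P : Set (I → ℝ)) : Prop :=
  P = (fun y i => y (name i)) '' Q.solutions

end LinearSystem

/-- Names of variables: `z_v` for a node `v`, `z_s` for a signed edge `s`, and an infinite supply of
further auxiliary variables. -/
inductive VarName (α : Type*) where
  | node (v : α)
  | edge (s : SignedEdge α)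
  | aux (k : ℕ)

/-- The names of the coordinates of the space `ℝ^(V ∪ S)`. A node or signed edge that belongs to two
signed hypergraphs has the same name in both. -/
def SignedHypergraph.varName {α : Type*} (H : SignedHypergraph α) : H.V ⊕ H.S → VarName α
  | Sum.inl v => VarName.node v.1
  | Sum.inr s => VarName.edge s.1

/-!
The polytope of `H` is recovered from that of `H - v`, for a single beta-leaf `v`, as follows. The
restrictions `s - v` of the signed edges `s` containing `v` cut out faces ("cylinders") of the cube on
the remaining nodes. Since `v` is a beta-leaf, the node sets of these restrictions form a chain, so two
of the cylinders are either nested or disjoint: together with the whole cube they form a tree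
(`SignedHypergraph.traces`, `SignedHypergraph.traces_chain`).

A point of the polytope of `H - v` gives the probabilities, under some distribution on the binary
points, of the cylinders in this tree. A point of the polytope of `H` arises from it by a random choice
of the value at `v`, and so splits the probability of each cylinder `i` into `a i + b i`. Conversely, by
`exists_split_of_tree`, a splitting arises in this way as soon as both `a` and `b` are superadditive
along the tree: the part of `i` outside the cylinders covered by `i` then has a mass which is split
into two nonnegative amounts, and every binary point in it is split in this same proportion. These
conditions are the inequalities of `SignedHypergraph.leafSystem`, two for each cylinder, besides the
equations relating `a`, `b` and the variables of `H - v`. Their number is linear in `|S|` and does not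
involve the rank, which enters only through `2 ≤ r` when the bounds are compared.

All variables used are products of literals, named by signed edges. A binary point therefore satisfies
the systems of all the steps at once, with each variable set to the value of its product
(`binaryPoint`), and the systems for a sequence of beta-leaves can be put together.
-/

/-! ### Splitting a distribution along a tree -/

section Tree

variable {ι Ω : Type*} [Fintype ι] [PartialOrder ι] [Fintype Ω]

open Classical in
/-- In a finite poset whose principal up-sets are chains, the points below `i` are those equal to `i`
together with those below exactly one of the elements covered by `i`. -/
theorem sum_le_eq_sum_eq_add_sum_covBy
    (hchain : ∀ i j k : ι, i ≤ j → i ≤ k → j ≤ k ∨ k ≤ j) (c : Ω → ι) (g : Ω → ℝ) (i : ι) :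
    ∑ ω with c ω ≤ i, g ω =
      ∑ ω with c ω = i, g ω + ∑ j with j ⋖ i, ∑ ω with c ω ≤ j, g ω := by
  have hdisj : Set.PairwiseDisjoint (↑(Finset.univ.filter fun j => j ⋖ i) : Set ι)
      (fun j => Finset.univ.filter fun ω => c ω ≤ j) := by
    intro j hj k hk hjk
    simp only [Finset.coe_filter, Finset.mem_univ, true_and, Set.mem_ofPred_eq] at hj hk
    refine Finset.disjoint_left.2 fun ω hωj hωk => hjk ?_
    simp only [Finset.mem_filter, Finset.mem_univ, true_and] at hωj hωk
    rcases hchain _ _ _ hωj hωk with h | h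
    · exact (hj.eq_or_eq h hk.le).elim Eq.symm fun h' => absurd h' hk.ne
    · exact (hk.eq_or_eq h hj.le).elim id fun h' => absurd h' hj.ne
  rw [← Finset.sum_biUnion hdisj, ← Finset.sum_union]
  · refine Finset.sum_congr ?_ fun _ _ => rfl
    ext ω
    simp only [Finset.mem_filter, Finset.mem_univ, true_and, Finset.mem_union, Finset.mem_biUnion]
    constructor
    · intro h
      rcases h.eq_or_lt with h | h
      · exact Or.inl h
      · obtain ⟨j, h1, h2⟩ := exists_le_covBy_of_lt h
        exact Or.inr ⟨j, h2, h1⟩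
    · rintro (h | ⟨j, h1, h2⟩)
      · exact h.le
      · exact h2.trans h1.le
  · refine Finset.disjoint_left.2 fun ω h1 h2 => ?_
    simp only [Finset.mem_filter, Finset.mem_univ, true_and, Finset.mem_biUnion] at h1 h2
    obtain ⟨j, hj, h2⟩ := h2
    exact (h2.trans_lt hj.lt).ne h1

open Classical in
/-- Masses `w` sit on the vertices of a tree (`c ω` is the position of `ω`, and larger means closer
to the root). If the mass of each subtree is split as `a i + b i` and both parts are superadditive
along the tree, then the splitting comes from splitting the individual masses. -/
theorem exists_split_of_tree
    (hchain : ∀ i j k : ι, i ≤ j → i ≤ k → j ≤ k ∨ k ≤ j) (c : Ω → ι)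
    (w : Ω → ℝ) (hw : ∀ ω, 0 ≤ w ω) (a b : ι → ℝ)
    (hab : ∀ i, a i + b i = ∑ ω with c ω ≤ i, w ω)
    (ha : ∀ i, ∑ j with j ⋖ i, a j ≤ a i) (hb : ∀ i, ∑ j with j ⋖ i, b j ≤ b i) :
    ∃ q : Ω → ℝ, (∀ ω, 0 ≤ q ω ∧ q ω ≤ 1) ∧ ∀ i, ∑ ω with c ω ≤ i, w ω * q ω = a i := by
  set m : ι → ℝ := fun i => ∑ ω with c ω = i, w ω with hm
  set n : ι → ℝ := fun i => a i - ∑ j with j ⋖ i, a j with hn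
  have hn0 : ∀ i, 0 ≤ n i := fun i => sub_nonneg.2 (ha i)
  have hm0 : ∀ i, 0 ≤ m i := fun i => Finset.sum_nonneg fun ω _ => hw ω
  have hnm : ∀ i, n i ≤ m i := by
    intro i
    have h1 := sum_le_eq_sum_eq_add_sum_covBy hchain c w i
    have h2 : ∑ j with j ⋖ i, ∑ ω with c ω ≤ j, w ω =
        ∑ j with j ⋖ i, a j + ∑ j with j ⋖ i, b j := by
      rw [← Finset.sum_add_distrib]
      exact Finset.sum_congr rfl fun j _ => (hab j).symm
    have h3 := hb i
    rw [← hab i, h2] at h1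
    simp only [hn, hm]
    linarith
  -- Every mass at the vertex `i` is split in the same proportion. Where `m i = 0` the quotient is
  -- `0`, which is right because then `n i = 0` too.
  refine ⟨fun ω => n (c ω) / m (c ω), fun ω => ⟨div_nonneg (hn0 _) (hm0 _),
    div_le_one_of_le₀ (hnm _) (hm0 _)⟩, fun i => ?_⟩
  have hatom : ∀ i, ∑ ω with c ω = i, w ω * (n (c ω) / m (c ω)) = n i := by
    intro i
    have h : ∑ ω with c ω = i, w ω * (n (c ω) / m (c ω)) = m i * (n i / m i) := by
      rw [hm, Finset.sum_mul]
      refine Finset.sum_congr rfl fun ω hω => ?_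
      rw [(Finset.mem_filter.1 hω).2]
    rw [h]
    rcases eq_or_ne (m i) 0 with h0 | h0
    · have := hnm i
      have := hn0 i
      rw [h0, zero_mul]
      linarith
    · exact mul_div_cancel₀ _ h0
  induction i using (wellFounded_lt (α := ι)).induction with
  | _ i ih =>
    rw [sum_le_eq_sum_eq_add_sum_covBy hchain c _ i, hatom,
      Finset.sum_congr rfl fun j hj => ih j (Finset.mem_filter.1 hj).2.lt]
    simp [hn]

end Tree

/-! ### Signed edges as sets of literals -/

namespace SignedEdge

variable {α : Type*}

/-- The literals of a signed edge: its nodes, each paired with its sign. -/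
def lits (s : SignedEdge α) : Set (α × ℤˣ) := {p | ∃ h : p.1 ∈ s.edge, s.sign ⟨p.1, h⟩ = p.2}

theorem mem_edge_iff (s : SignedEdge α) (u : α) : u ∈ s.edge ↔ ∃ ε, (u, ε) ∈ s.lits :=
  ⟨fun h => ⟨s.sign ⟨u, h⟩, h, rfl⟩, fun ⟨_, h, _⟩ => h⟩

theorem mem_lits_sign (s : SignedEdge α) (u : s.edge) : (u.1, s.sign u) ∈ s.lits := ⟨u.2, rfl⟩

theorem lits_injective : Function.Injective (lits : SignedEdge α → Set (α × ℤˣ)) := by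
  intro s t h
  have he : s.edge = t.edge := by
    ext u
    rw [mem_edge_iff, mem_edge_iff, h]
  obtain ⟨e, f⟩ := s
  obtain ⟨e', f'⟩ := t
  obtain rfl : e = e' := he
  congr 1
  funext u
  have : (u.1, f u) ∈ (⟨e, f'⟩ : SignedEdge α).lits := h ▸ mem_lits_sign ⟨e, f⟩ u
  exact this.2.symm

/-- Signed edges are ordered as the cylinders they cut out of the cube: `s ≤ t` if every literal of
`t` is one of `s`. The signed edge without nodes is the largest. -/
instance : PartialOrder (SignedEdge α) :=
  PartialOrder.lift (fun s => OrderDual.toDual s.lits) fun _ _ h => lits_injective h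

/-- The binary point with support `x` lies in the cylinder of `s`: all literals of `s` are true. -/
def Sat (s : SignedEdge α) (x : Set α) : Prop := ∀ p ∈ s.lits, (p.2 = 1 ↔ p.1 ∈ x)

theorem Sat.mono {s t : SignedEdge α} {x : Set α} (hs : s.Sat x) (h : s ≤ t) : t.Sat x :=
  fun p hp => hs p (h hp)

/-- Two signed edges on nested node sets whose signs do not conflict are comparable. -/
theorem le_total_of_edge_subset {s t : SignedEdge α} (he : s.edge ⊆ t.edge ∨ t.edge ⊆ s.edge)
    (hst : ∀ u ε δ, (u, ε) ∈ s.lits → (u, δ) ∈ t.lits → ε = δ) : s ≤ t ∨ t ≤ s := by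
  rcases he with h | h
  · refine Or.inr fun p hp => ?_
    obtain ⟨δ, hδ⟩ := (t.mem_edge_iff p.1).1 (h hp.1)
    obtain rfl : p.2 = δ := hst _ _ _ hp hδ
    exact hδ
  · refine Or.inl fun p hp => ?_
    obtain ⟨δ, hδ⟩ := (s.mem_edge_iff p.1).1 (h hp.1)
    obtain rfl : δ = p.2 := hst _ _ _ hδ hp
    exact hδ

theorem sign_unique {s : SignedEdge α} {u : α} {ε δ : ℤˣ} (h : (u, ε) ∈ s.lits)
    (h' : (u, δ) ∈ s.lits) : ε = δ := h.2.symm.trans h'.2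

theorem prod_sigma_eq (s : SignedEdge α) (x : Set α) [Decidable (s.Sat x)]
    [∀ u, Decidable (u ∈ x)] (f : s.edge → ℝ)
    (hf : ∀ u, f u = if u.1 ∈ x then 1 else 0) :
    ∏ u : s.edge, s.sigma u (f u) = if s.Sat x then 1 else 0 := by
  have h1 : ∀ u : s.edge, s.sigma u (f u) = if (s.sign u = 1 ↔ u.1 ∈ x) then 1 else 0 := by
    intro u
    rw [hf, sigma]
    by_cases h : s.sign u = 1 <;> by_cases h' : u.1 ∈ x <;> simp [h, h']
  simp only [h1]
  rw [Finset.prod_ite_zero, Finset.prod_const_one]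
  refine if_congr ⟨fun h p hp => ?_, fun h u _ => h _ (s.mem_lits_sign u)⟩ rfl rfl
  rw [← hp.2]
  exact h ⟨p.1, hp.1⟩ (Finset.mem_univ _)

/-- The signed edge without nodes. -/
def empty : SignedEdge α where
  edge := ∅
  sign := fun u => absurd u.2 (Finset.notMem_empty _)

theorem lits_empty : (empty : SignedEdge α).lits = ∅ :=
  Set.eq_empty_of_forall_notMem fun _ h => absurd h.1 (Finset.notMem_empty _)

theorem sat_empty (x : Set α) : (empty : SignedEdge α).Sat x := by simp [Sat, lits_empty]

theorem eq_empty {s : SignedEdge α} (h : ¬s.edge.Nonempty) : s = empty := by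
  refine lits_injective ?_
  rw [lits_empty]
  exact Set.eq_empty_of_forall_notMem fun p hp => h ⟨_, hp.1⟩

theorem mem_lits_remove {s : SignedEdge α} {v : α} {p : α × ℤˣ} :
    p ∈ (s.remove v).lits ↔ p.1 ≠ v ∧ p ∈ s.lits := by
  classical
  constructor
  · rintro ⟨h, h'⟩
    exact ⟨(Finset.mem_erase.1 h).1, (Finset.mem_erase.1 h).2, h'⟩
  · rintro ⟨h, h', h''⟩
    exact ⟨Finset.mem_erase.2 ⟨h, h'⟩, h''⟩

theorem remove_eq_self {s : SignedEdge α} {v : α} (h : v ∉ s.edge) : s.remove v = s := by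
  refine lits_injective (Set.ext fun p => ?_)
  rw [mem_lits_remove]
  exact ⟨And.right, fun hp => ⟨fun he => h (he ▸ hp.1), hp⟩⟩

open Classical in
/-- The signed edge `s` with the node `v` added, with sign `ε`; it is used for `v ∉ s`. -/
noncomputable def insertNode (s : SignedEdge α) (v : α) (ε : ℤˣ) : SignedEdge α where
  edge := insert v s.edge
  sign := fun u => if h : u.1 = v then ε else s.sign ⟨u.1, (Finset.mem_insert.1 u.2).resolve_left h⟩

theorem mem_lits_insertNode {s : SignedEdge α} {v : α} {ε : ℤˣ} (hv : v ∉ s.edge) {p : α × ℤˣ} :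
    p ∈ (s.insertNode v ε).lits ↔ p = (v, ε) ∨ p ∈ s.lits := by
  obtain ⟨u, δ⟩ := p
  by_cases h : u = v
  · subst h
    simp [lits, insertNode, hv, eq_comm]
  · simp [lits, insertNode, h]

theorem insertNode_remove {s : SignedEdge α} {v : α} {ε : ℤˣ} (h : (v, ε) ∈ s.lits) :
    (s.remove v).insertNode v ε = s := by
  refine lits_injective (Set.ext fun p => ?_)
  rw [mem_lits_insertNode (by simp [remove]), mem_lits_remove]
  constructor
  · rintro (rfl | h')
    exacts [h, h'.2]
  · intro hp
    by_cases hpv : p.1 = v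
    · left
      obtain ⟨u, δ⟩ := p
      obtain rfl : u = v := hpv
      rw [sign_unique h hp]
    · exact Or.inr ⟨hpv, hp⟩

theorem remove_insertNode {s : SignedEdge α} {v : α} {ε : ℤˣ} (hv : v ∉ s.edge) :
    (s.insertNode v ε).remove v = s := by
  refine lits_injective (Set.ext fun p => ?_)
  rw [mem_lits_remove, mem_lits_insertNode hv]
  constructor
  · rintro ⟨h, rfl | h'⟩
    exacts [absurd rfl h, h']
  · exact fun h => ⟨fun he => hv (he ▸ h.1), Or.inr h⟩

theorem sat_insertNode {s : SignedEdge α} {v : α} {ε : ℤˣ} (hv : v ∉ s.edge) (x : Set α) :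
    (s.insertNode v ε).Sat x ↔ (ε = 1 ↔ v ∈ x) ∧ s.Sat x := by
  simp only [Sat, mem_lits_insertNode hv, forall_eq_or_imp]

theorem sat_congr {s : SignedEdge α} {x y : Set α} (h : ∀ u ∈ s.edge, (u ∈ x ↔ u ∈ y)) :
    s.Sat x ↔ s.Sat y :=
  forall₂_congr fun p hp => by rw [h p.1 hp.1]

end SignedEdge

/-! ### Binary points, with values for all variable names -/

section Point

variable {α : Type*}

open Classical in
/-- The binary point with support `x`, extended to all variable names: the variable of any signed
edge `s`, whether or not it belongs to the signed hypergraph at hand, gets the value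
`∏_{v ∈ s} σ_s(z_v)`. -/
noncomputable def binaryPoint (x : Set α) : VarName α → ℝ
  | .node u => if u ∈ x then 1 else 0
  | .edge s => if s.Sat x then 1 else 0
  | .aux _ => 0

theorem SignedHypergraph.pbs_eq_range (H : SignedHypergraph α) :
    H.pbs = Set.range fun (x : Set α) i => binaryPoint x (H.varName i) := by
  classical
  ext z
  constructor
  · rintro ⟨h01, hz⟩
    obtain ⟨x, hx⟩ : ∃ x : Set α, x = {u | ∃ h : u ∈ H.V, z (Sum.inl ⟨u, h⟩) = 1} := ⟨_, rfl⟩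
    have hnode : ∀ u : H.V, z (Sum.inl u) = if u.1 ∈ x then 1 else 0 := by
      intro u
      have hu : u.1 ∈ x ↔ z (Sum.inl u) = 1 := hx ▸ ⟨fun h => h.2, fun h => ⟨u.2, h⟩⟩
      rw [if_congr hu rfl rfl]
      rcases h01 (Sum.inl u) with h | h <;> simp [h]
    refine ⟨x, funext fun i => ?_⟩
    rcases i with u | s
    · simp only [varName, binaryPoint]
      exact (hnode u).symm
    · simp only [varName, binaryPoint]
      rw [hz s, s.1.prod_sigma_eq x _ fun u => hnode _]
  · rintro ⟨x, rfl⟩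
    refine ⟨fun i => ?_, fun s => ?_⟩
    · rcases i with u | s <;> simp only [varName, binaryPoint] <;> split_ifs <;> simp
    · simp only [varName, binaryPoint]
      rw [s.1.prod_sigma_eq x _ fun u => rfl]

/-- A point of the pseudo-Boolean polytope is the expectation of a random binary point. -/
theorem SignedHypergraph.exists_weights_of_mem_pbp (H : SignedHypergraph α) {y : H.V ⊕ H.S → ℝ}
    (hy : y ∈ H.pbp) :
    ∃ (k : ℕ) (w : Fin k → ℝ) (X : Fin k → Set α), (∀ ω, 0 ≤ w ω) ∧ ∑ ω, w ω = 1 ∧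
      ∀ i, y i = ∑ ω, w ω * binaryPoint (X ω) (H.varName i) := by
  obtain ⟨κ, _, w, z, hw, hw1, hz, rfl⟩ := mem_convexHull_iff_exists_fintype.1 hy
  rw [H.pbs_eq_range] at hz
  choose X hX using hz
  let e := Fintype.equivFin κ
  refine ⟨Fintype.card κ, w ∘ e.symm, X ∘ e.symm, fun ω => hw _, ?_, fun i => ?_⟩
  · rw [← hw1]
    exact e.symm.sum_comp w
  · rw [Finset.sum_apply]
    simp only [Function.comp_apply]
    rw [e.symm.sum_comp fun k => w k * binaryPoint (X k) (H.varName i)]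
    simp [← hX]

theorem SignedHypergraph.binaryPoint_mem_pbp (H : SignedHypergraph α) (x : Set α) :
    (fun i => binaryPoint x (H.varName i)) ∈ H.pbp :=
  subset_convexHull ℝ _ (H.pbs_eq_range ▸ ⟨x, rfl⟩)

end Point

/-! ### Linear systems with coefficients `0`, `1`, `-1` -/

namespace LinearSystem

variable {X : Type*}

open Classical in
/-- The inequality `∑ x ∈ P, y x - ∑ x ∈ N, y x ≤ b`. -/
noncomputable def signedIneq (P N : Finset X) (b : ℝ) : (X →₀ ℝ) × ℝ :=
  (∑ x ∈ P, Finsupp.single x 1 - ∑ x ∈ N, Finsupp.single x 1, b)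

theorem signedIneq_sum (P N : Finset X) (b : ℝ) (y : X → ℝ) :
    ((signedIneq P N b).1.sum fun x a => a * y x) = ∑ x ∈ P, y x - ∑ x ∈ N, y x := by
  have h : ∀ c : X →₀ ℝ, (c.sum fun x a => a * y x) = Finsupp.linearCombination ℝ y c := by
    intro c
    simp [Finsupp.linearCombination_apply]
  rw [h, signedIneq, map_sub, map_sum, map_sum]
  simp

theorem signedIneq_apply [DecidableEq X] (P N : Finset X) (b : ℝ) (x : X) :
    (signedIneq P N b).1 x = (if x ∈ P then 1 else 0) - if x ∈ N then 1 else 0 := by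
  simp [signedIneq, Finsupp.single_apply]

theorem signedIneq_coeff (P N : Finset X) (b : ℝ) (x : X) :
    (signedIneq P N b).1 x = 0 ∨ (signedIneq P N b).1 x = 1 ∨ (signedIneq P N b).1 x = -1 := by
  classical
  rw [signedIneq_apply]
  split_ifs <;> simp

theorem signedIneq_support [DecidableEq X] (P N : Finset X) (b : ℝ) :
    (signedIneq P N b).1.support ⊆ P ∪ N := by
  intro x hx
  by_contra h
  rw [Finset.mem_union, not_or] at h
  exact Finsupp.mem_support_iff.1 hx (by simp [signedIneq_apply, h])

theorem mem_solutions_juxtapose {Q D : LinearSystem X} {y : X → ℝ} :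
    y ∈ (Q.juxtapose D).solutions ↔ y ∈ Q.solutions ∧ y ∈ D.solutions := by
  simp only [solutions, juxtapose, Set.mem_ofPred_eq, Finset.mem_union, or_imp, forall_and]

theorem HasSignData.juxtapose {Q D : LinearSystem X} (hQ : Q.HasSignData) (hD : D.HasSignData) :
    (Q.juxtapose D).HasSignData := by
  classical
  exact fun c hc => (Finset.mem_union.1 hc).elim (hQ c) (hD c)

theorem card_ineqs_juxtapose_le (Q D : LinearSystem X) :
    (Q.juxtapose D).ineqs.card ≤ Q.ineqs.card + D.ineqs.card := by
  classical
  exact Finset.card_union_le _ _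

theorem card_vars_juxtapose_le (Q D : LinearSystem X) :
    (Q.juxtapose D).vars.card ≤ Q.vars.card + D.vars.card := by
  classical
  have h : (Q.juxtapose D).vars = Q.vars ∪ D.vars := by
    ext x
    simp [vars, juxtapose, or_and_right, exists_or]
  rw [h]
  exact Finset.card_union_le _ _

/-- Being a solution depends only on the values of the variables of the system. -/
theorem mem_solutions_congr (Q : LinearSystem X) {y z : X → ℝ} (h : ∀ x ∈ Q.vars, y x = z x)
    (hz : z ∈ Q.solutions) : y ∈ Q.solutions := by
  classical
  intro c hc
  refine le_of_eq_of_le (Finset.sum_congr rfl fun x hx => ?_) (hz c hc)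
  simp only
  rw [h x (Finset.mem_biUnion.2 ⟨c, hc, hx⟩)]

theorem convex_solutions (Q : LinearSystem X) : Convex ℝ Q.solutions := by
  intro y hy z hz s t hs ht hst c hc
  have h1 := mul_le_mul_of_nonneg_left (hy c hc) hs
  have h2 := mul_le_mul_of_nonneg_left (hz c hc) ht
  have h3 : (c.1.sum fun x a => a * (s • y + t • z) x) =
      s * (c.1.sum fun x a => a * y x) + t * (c.1.sum fun x a => a * z x) := by
    simp only [Finsupp.sum, Finset.mul_sum, ← Finset.sum_add_distrib]
    refine Finset.sum_congr rfl fun x _ => ?_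
    simp only [Pi.add_apply, Pi.smul_apply, smul_eq_mul]
    ring
  rw [h3]
  calc _ ≤ s * c.2 + t * c.2 := add_le_add h1 h2
    _ = c.2 := by rw [← add_mul, hst, one_mul]

end LinearSystem

/-! ### Removal of one beta-leaf -/

namespace SignedHypergraph

variable {α : Type*}

theorem card_S_removeNode_le (H : SignedHypergraph α) (v : α) :
    (H.removeNode v).S.card ≤ H.S.card := by
  classical
  exact (Finset.card_filter_le _ _).trans Finset.card_image_le

theorem mem_S_removeNode {H : SignedHypergraph α} {v : α} {s : SignedEdge α} :
    s ∈ (H.removeNode v).S ↔ s.edge.Nonempty ∧ ∃ t ∈ H.S, t.remove v = s := by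
  classical
  simp only [removeNode, Finset.mem_filter, Finset.mem_image, Finset.one_le_card]
  exact and_comm

theorem coe_edge_remove (s : SignedEdge α) (v : α) :
    {u | u ∈ (s.remove v).edge} = {u | u ∈ s.edge} \ {v} := by
  ext u
  simp [SignedEdge.remove, and_comm]

theorem underlying_removeNode (H : SignedHypergraph α) (v : α) :
    (H.removeNode v).underlying = H.underlying.removeNode v := by
  have hV : (H.removeNode v).underlying.vertexSet = (H.underlying.removeNode v).vertexSet := by
    ext u
    simp [underlying, removeNode, Hypergraph.removeNode, and_comm]
  have hE : (H.removeNode v).underlying.edgeSet = (H.underlying.removeNode v).edgeSet := by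
    ext e
    constructor
    · rintro ⟨s, hs, rfl⟩
      obtain ⟨h, t, ht, rfl⟩ := mem_S_removeNode.1 hs
      exact ⟨h, _, ⟨t, ht, rfl⟩, coe_edge_remove t v⟩
    · rintro ⟨h, _, ⟨t, ht, rfl⟩, rfl⟩
      rw [← coe_edge_remove] at h ⊢
      exact ⟨_, mem_S_removeNode.2 ⟨h, t, ht, rfl⟩, rfl⟩
  exact Hypergraph.ext hV hE

open Classical in
/-- The traces at `v`: the signed edges `s - v` for the signed edges `s` containing `v`, and the
signed edge without nodes. If `v` is a beta-leaf, they form a tree with the latter as its root. -/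
noncomputable def traces (H : SignedHypergraph α) (v : α) : Finset (SignedEdge α) :=
  insert SignedEdge.empty ((H.S.filter fun s => v ∈ s.edge).image fun s => s.remove v)

theorem card_traces_le (H : SignedHypergraph α) (v : α) : (H.traces v).card ≤ H.S.card + 1 := by
  classical
  exact (Finset.card_insert_le _ _).trans
    (Nat.succ_le_succ (Finset.card_image_le.trans (Finset.card_filter_le _ _)))

theorem empty_mem_traces (H : SignedHypergraph α) (v : α) : SignedEdge.empty ∈ H.traces v := by
  classical
  exact Finset.mem_insert_self _ _

theorem remove_mem_traces {H : SignedHypergraph α} {v : α} {s : SignedEdge α} (hs : s ∈ H.S)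
    (hv : v ∈ s.edge) : s.remove v ∈ H.traces v := by
  classical
  exact Finset.mem_insert_of_mem (Finset.mem_image_of_mem _ (Finset.mem_filter.2 ⟨hs, hv⟩))

theorem eq_empty_or_of_mem_traces {H : SignedHypergraph α} {v : α} {s : SignedEdge α}
    (h : s ∈ H.traces v) :
    s = SignedEdge.empty ∨ ∃ t ∈ H.S, v ∈ t.edge ∧ t.remove v = s := by
  classical
  simpa [traces, and_assoc] using h

theorem notMem_edge_of_mem_traces {H : SignedHypergraph α} {v : α} {s : SignedEdge α}
    (h : s ∈ H.traces v) : v ∉ s.edge := by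
  rcases eq_empty_or_of_mem_traces h with rfl | ⟨t, -, -, rfl⟩
  · exact Finset.notMem_empty v
  · simp [SignedEdge.remove]

theorem edge_subset_or_of_mem_traces {H : SignedHypergraph α} {v : α}
    (hv : H.underlying.IsBetaLeaf v) {s t : SignedEdge α} (hs : s ∈ H.traces v)
    (ht : t ∈ H.traces v) : s.edge ⊆ t.edge ∨ t.edge ⊆ s.edge := by
  classical
  rcases eq_empty_or_of_mem_traces hs with rfl | ⟨s, hs', hvs, rfl⟩
  · exact Or.inl (Finset.empty_subset _)
  rcases eq_empty_or_of_mem_traces ht with rfl | ⟨t, ht', hvt, rfl⟩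
  · exact Or.inr (Finset.empty_subset _)
  exact (hv.2.total ⟨⟨s, hs', rfl⟩, hvs⟩ ⟨⟨t, ht', rfl⟩, hvt⟩).imp
    (fun h => Finset.erase_subset_erase _ h) fun h => Finset.erase_subset_erase _ h

theorem traces_chain {H : SignedHypergraph α} {v : α} (hv : H.underlying.IsBetaLeaf v)
    (i j k : H.traces v) (hij : i ≤ j) (hik : i ≤ k) : j ≤ k ∨ k ≤ j :=
  SignedEdge.le_total_of_edge_subset (edge_subset_or_of_mem_traces hv j.2 k.2)
    fun _ _ _ h h' => SignedEdge.sign_unique (hij h) (hik h')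

/-- The traces whose cylinders contain a given binary point form a chain, so there is a smallest one
among them. -/
theorem exists_min_trace {H : SignedHypergraph α} {v : α} (hv : H.underlying.IsBetaLeaf v)
    (x : Set α) : ∃ i : H.traces v, ∀ j : H.traces v, i ≤ j ↔ j.1.Sat x := by
  classical
  obtain ⟨i, hi⟩ := (Finset.univ.filter fun j : H.traces v => j.1.Sat x).exists_minimal
    ⟨⟨_, H.empty_mem_traces v⟩, by simpa using SignedEdge.sat_empty x⟩
  have hix : i.1.Sat x := by simpa using hi.1
  refine ⟨i, fun j => ⟨fun h => hix.mono h, fun hj => ?_⟩⟩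
  have hcomp : i ≤ j ∨ j ≤ i := by
    refine SignedEdge.le_total_of_edge_subset (edge_subset_or_of_mem_traces hv i.2 j.2)
      fun u ε δ h h' => ?_
    have h1 : ε = 1 ↔ δ = 1 := (hix _ h).trans (hj _ h').symm
    rcases Int.units_eq_one_or ε with rfl | rfl <;> rcases Int.units_eq_one_or δ with rfl | rfl
    · rfl
    · exact (h1.1 rfl).symm
    · exact h1.2 rfl
    · rfl
  exact hcomp.elim id fun h => hi.2 (by simpa using hj) h

/-- The variable of the signed edge obtained from the trace `i` by adding `v` with sign `ε`. -/
noncomputable def lift (H : SignedHypergraph α) (v : α) (ε : ℤˣ) (i : H.traces v) : VarName α :=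
  .edge (i.1.insertNode v ε)

theorem lift_injective (H : SignedHypergraph α) (v : α) (ε : ℤˣ) :
    Function.Injective (H.lift v ε) := by
  intro i j h
  have h' : (i.1.insertNode v ε).remove v = (j.1.insertNode v ε).remove v := by
    rw [VarName.edge.inj h]
  rw [SignedEdge.remove_insertNode (notMem_edge_of_mem_traces i.2),
    SignedEdge.remove_insertNode (notMem_edge_of_mem_traces j.2)] at h'
  exact Subtype.ext h'

theorem lift_one_ne_lift_neg_one (H : SignedHypergraph α) (v : α) (i : H.traces v) :
    H.lift v 1 i ≠ H.lift v (-1) i := by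
  intro h
  have h1 : (v, (1 : ℤˣ)) ∈ (i.1.insertNode v (-1)).lits := by
    rw [← VarName.edge.inj h, SignedEdge.mem_lits_insertNode (notMem_edge_of_mem_traces i.2)]
    exact Or.inl rfl
  rw [SignedEdge.mem_lits_insertNode (notMem_edge_of_mem_traces i.2)] at h1
  rcases h1 with h1 | h1
  · exact absurd (show (1 : ℤˣ) = -1 from (Prod.ext_iff.1 h1).2) (by decide)
  · exact notMem_edge_of_mem_traces i.2 h1.1

open Classical in
/-- The system added when the node `v` is put back. Let `a i` and `b i` be the variables of the trace
`i` with `v` added positively and negatively. The inequalities say that `a` and `b` are superadditive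
along the tree of traces, `a i + b i` is the variable of `i`, and at the root this variable is `1` and
`a` is the variable of `v`. -/
noncomputable def leafSystem (H : SignedHypergraph α) (v : α) : LinearSystem (VarName α) where
  ineqs :=
    (Finset.univ.image fun i : H.traces v => LinearSystem.signedIneq
      ((Finset.univ.filter fun j => j ⋖ i).image (H.lift v 1)) {H.lift v 1 i} 0) ∪
    (Finset.univ.image fun i : H.traces v => LinearSystem.signedIneq
      ((Finset.univ.filter fun j => j ⋖ i).image (H.lift v (-1))) {H.lift v (-1) i} 0) ∪
    (Finset.univ.image fun i : H.traces v => LinearSystem.signedIneq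
      {H.lift v 1 i, H.lift v (-1) i} {VarName.edge i.1} 0) ∪
    (Finset.univ.image fun i : H.traces v => LinearSystem.signedIneq
      {VarName.edge i.1} {H.lift v 1 i, H.lift v (-1) i} 0) ∪
    {LinearSystem.signedIneq {VarName.edge SignedEdge.empty} ∅ 1,
      LinearSystem.signedIneq ∅ {VarName.edge SignedEdge.empty} (-1),
      LinearSystem.signedIneq {VarName.node v} {H.lift v 1 ⟨_, H.empty_mem_traces v⟩} 0,
      LinearSystem.signedIneq {H.lift v 1 ⟨_, H.empty_mem_traces v⟩} {VarName.node v} 0}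

open Classical in
theorem mem_leafSystem_solutions (H : SignedHypergraph α) (v : α) (y : VarName α → ℝ) :
    y ∈ (H.leafSystem v).solutions ↔
      (∀ (ε : ℤˣ) (i : H.traces v), ∑ j with j ⋖ i, y (H.lift v ε j) ≤ y (H.lift v ε i)) ∧
      (∀ i : H.traces v, y (H.lift v 1 i) + y (H.lift v (-1) i) = y (.edge i.1)) ∧
      y (.edge SignedEdge.empty) = 1 ∧
      y (H.lift v 1 ⟨_, H.empty_mem_traces v⟩) = y (.node v) := by
  have hε : ∀ p : ℤˣ → Prop, (∀ ε, p ε) ↔ p 1 ∧ p (-1) := fun p =>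
    ⟨fun h => ⟨h _, h _⟩, fun h ε => (Int.units_eq_one_or ε).elim (· ▸ h.1) (· ▸ h.2)⟩
  rw [hε]
  simp only [LinearSystem.solutions, leafSystem, Set.mem_ofPred_eq, Finset.mem_union, or_imp,
    forall_and, Finset.mem_image, Finset.mem_univ, true_and, forall_exists_index,
    forall_apply_eq_imp_iff, Finset.mem_insert, Finset.mem_singleton, forall_eq,
    LinearSystem.signedIneq_sum]
  simp only [LinearSystem.signedIneq, Finset.sum_image fun i _ j _ h => H.lift_injective v _ h,
    Finset.sum_pair (H.lift_one_ne_lift_neg_one v _), Finset.sum_singleton, Finset.sum_empty]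
  constructor
  · rintro ⟨⟨⟨⟨h1, h2⟩, h3⟩, h4⟩, h5, h6, h7, h8⟩
    exact ⟨⟨fun i => by linarith [h1 i], fun i => by linarith [h2 i]⟩,
      fun i => by linarith [h3 i, h4 i], by linarith, by linarith⟩
  · rintro ⟨⟨h1, h2⟩, h3, h4, h5⟩
    exact ⟨⟨⟨⟨fun i => by linarith [h1 i], fun i => by linarith [h2 i]⟩,
      fun i => by linarith [h3 i]⟩, fun i => by linarith [h3 i]⟩, by linarith, by linarith,
      by linarith, by linarith⟩

theorem leafSystem_hasSignData (H : SignedHypergraph α) (v : α) :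
    (H.leafSystem v).HasSignData := by
  have key : ∀ P N : Finset (VarName α), ∀ b : ℝ, (b = 0 ∨ b = 1 ∨ b = -1) →
      (∀ x, (LinearSystem.signedIneq P N b).1 x = 0 ∨ (LinearSystem.signedIneq P N b).1 x = 1 ∨
        (LinearSystem.signedIneq P N b).1 x = -1) ∧
      ((LinearSystem.signedIneq P N b).2 = 0 ∨ (LinearSystem.signedIneq P N b).2 = 1 ∨
        (LinearSystem.signedIneq P N b).2 = -1) :=
    fun P N b hb => ⟨LinearSystem.signedIneq_coeff P N b, hb⟩
  intro c hc
  simp only [leafSystem, Finset.mem_union, Finset.mem_image, Finset.mem_univ, true_and,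
    Finset.mem_insert, Finset.mem_singleton] at hc
  rcases hc with (((⟨i, rfl⟩ | ⟨i, rfl⟩) | ⟨i, rfl⟩) | ⟨i, rfl⟩) | (rfl | rfl | rfl | rfl) <;>
    exact key _ _ _ (by simp)

theorem card_leafSystem_ineqs_le (H : SignedHypergraph α) (v : α) :
    (H.leafSystem v).ineqs.card ≤ 4 * H.S.card + 8 := by
  classical
  have hu : (Finset.univ : Finset (H.traces v)).card ≤ H.S.card + 1 := by
    simpa using H.card_traces_le v
  have h4 : 4 * (Finset.univ : Finset (H.traces v)).card + 4 ≤ 4 * H.S.card + 8 := by omega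
  refine le_trans ?_ h4
  simp only [leafSystem]
  have hi : ∀ f : H.traces v → (VarName α →₀ ℝ) × ℝ, (Finset.univ.image f).card ≤
      (Finset.univ : Finset (H.traces v)).card := fun f => Finset.card_image_le
  refine (Finset.card_union_le _ _).trans (add_le_add ((Finset.card_union_le _ _).trans ?_)
    Finset.card_le_four)
  refine (add_le_add ((Finset.card_union_le _ _).trans
    (add_le_add ((Finset.card_union_le _ _).trans (add_le_add (hi _) (hi _))) (hi _)))
    (hi _)).trans (by omega)

theorem card_leafSystem_vars_le (H : SignedHypergraph α) (v : α) :
    (H.leafSystem v).vars.card ≤ 3 * H.S.card + 4 := by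
  classical
  set T := (Finset.univ : Finset (H.traces v)) with hT
  have hu : T.card ≤ H.S.card + 1 := by simpa [hT] using H.card_traces_le v
  set W : Finset (VarName α) := T.image (H.lift v 1) ∪ T.image (H.lift v (-1)) ∪
    T.image (fun i => VarName.edge i.1) ∪ {VarName.node v} with hW
  have ha : ∀ i, H.lift v 1 i ∈ W := fun i => by simp [hW, hT]
  have hb : ∀ i, H.lift v (-1) i ∈ W := fun i => by simp [hW, hT]
  have hy : ∀ i : H.traces v, VarName.edge i.1 ∈ W := fun i =>
    Finset.mem_union_left _ (Finset.mem_union_right _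
      (Finset.mem_image_of_mem (fun i : H.traces v => VarName.edge i.1) (Finset.mem_univ i)))
  have hy0 : VarName.edge SignedEdge.empty ∈ W := hy ⟨_, H.empty_mem_traces v⟩
  have hn : VarName.node v ∈ W := by simp [hW]
  have key : ∀ P N : Finset (VarName α), ∀ b : ℝ, P ⊆ W → N ⊆ W →
      (LinearSystem.signedIneq P N b).1.support ⊆ W := fun P N b hP hN =>
    (LinearSystem.signedIneq_support P N b).trans (Finset.union_subset hP hN)
  have hsub : (H.leafSystem v).vars ⊆ W := by
    refine Finset.biUnion_subset.2 fun c hc => ?_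
    simp only [leafSystem, Finset.mem_union, Finset.mem_image, Finset.mem_univ, true_and,
      Finset.mem_insert, Finset.mem_singleton] at hc
    rcases hc with (((⟨i, rfl⟩ | ⟨i, rfl⟩) | ⟨i, rfl⟩) | ⟨i, rfl⟩) | (rfl | rfl | rfl | rfl) <;>
      refine key _ _ _ ?_ ?_ <;>
      simp [Finset.insert_subset_iff, Finset.image_subset_iff, ha, hb, hy, hy0, hn]
  refine (Finset.card_le_card hsub).trans ?_
  have hc : W.card ≤ T.card + T.card + T.card + 1 :=
    (Finset.card_union_le _ _).trans (add_le_add ((Finset.card_union_le _ _).trans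
      (add_le_add ((Finset.card_union_le _ _).trans
        (add_le_add Finset.card_image_le Finset.card_image_le)) Finset.card_image_le)) le_rfl)
  omega

end SignedHypergraph

namespace SignedHypergraph

variable {α : Type*}

theorem binaryPoint_lift {H : SignedHypergraph α} {v : α} (ε : ℤˣ) (i : H.traces v) (x : Set α)
    [Decidable ((ε = 1 ↔ v ∈ x) ∧ i.1.Sat x)] :
    binaryPoint x (H.lift v ε i) = if (ε = 1 ↔ v ∈ x) ∧ i.1.Sat x then 1 else 0 := by
  classical
  exact if_congr (SignedEdge.sat_insertNode (notMem_edge_of_mem_traces i.2) x) rfl rfl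

open Classical in
/-- Every binary point satisfies the system of a beta-leaf: the cylinders of the traces covered by
`i` are disjoint subsets of the cylinder of `i`. -/
theorem binaryPoint_mem_leafSystem_solutions {H : SignedHypergraph α} {v : α}
    (hv : H.underlying.IsBetaLeaf v) (x : Set α) : binaryPoint x ∈ (H.leafSystem v).solutions := by
  rw [mem_leafSystem_solutions]
  refine ⟨fun ε i => ?_, fun i => ?_, if_pos (SignedEdge.sat_empty x), ?_⟩
  · obtain ⟨c, hc⟩ := exists_min_trace hv x
    have h := sum_le_eq_sum_eq_add_sum_covBy (traces_chain hv) (fun _ : Unit => c)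
      (fun _ => if ε = 1 ↔ v ∈ x then 1 else 0) i
    have hval : ∀ j : H.traces v, binaryPoint x (H.lift v ε j) =
        ∑ _ω : Unit with c ≤ j, if ε = 1 ↔ v ∈ x then 1 else 0 := by
      intro j
      rw [binaryPoint_lift, Finset.sum_filter, Fintype.sum_unique, ← ite_and]
      exact if_congr (by rw [hc j, and_comm]) rfl rfl
    simp only [hval]
    rw [h]
    refine le_add_of_nonneg_left (Finset.sum_nonneg fun _ _ => ?_)
    split_ifs <;> norm_num
  · rw [binaryPoint_lift, binaryPoint_lift]
    by_cases h1 : v ∈ x <;> simp [h1, binaryPoint]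
  · rw [binaryPoint_lift]
    simp [SignedEdge.sat_empty, binaryPoint]

open Classical in
/-- The system of a beta-leaf `v` lifts points of the polytope of `H - v` to the polytope of `H`:
a random binary point of `H - v` is extended by a random value at `v`, whose conditional probabilities
`exists_split_of_tree` supplies. -/
theorem mem_pbp_of_mem_leafSystem_solutions {H : SignedHypergraph α} {v : α}
    (hv : H.underlying.IsBetaLeaf v) {y : VarName α → ℝ} (hy : y ∈ (H.leafSystem v).solutions)
    (hy' : (fun i => y ((H.removeNode v).varName i)) ∈ (H.removeNode v).pbp) :
    (fun i => y (H.varName i)) ∈ H.pbp := by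
  obtain ⟨hsup, hadd, hroot, hnode⟩ := (mem_leafSystem_solutions H v y).1 hy
  obtain ⟨k, w, X, hw, hw1, hX⟩ := (H.removeNode v).exists_weights_of_mem_pbp hy'
  choose c hc using fun ω => exists_min_trace hv (X ω)
  have hXnode : ∀ u ∈ H.V, u ≠ v → y (.node u) = ∑ ω, w ω * binaryPoint (X ω) (.node u) :=
    fun u hu huv => hX (Sum.inl ⟨u, Finset.mem_erase.2 ⟨huv, hu⟩⟩)
  have hXedge : ∀ s ∈ (H.removeNode v).S, y (.edge s) = ∑ ω, w ω * binaryPoint (X ω) (.edge s) :=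
    fun s hs => hX (Sum.inr ⟨s, hs⟩)
  have hXtrace : ∀ i : H.traces v, y (.edge i.1) = ∑ ω, w ω * binaryPoint (X ω) (.edge i.1) := by
    rintro ⟨s, hs⟩
    -- The root trace is not an edge of `H - v`; its variable is fixed by the system itself.
    by_cases hse : s.edge.Nonempty
    · rcases eq_empty_or_of_mem_traces hs with rfl | ⟨t, ht, -, rfl⟩
      · exact absurd hse Finset.not_nonempty_empty
      · exact hXedge _ (mem_S_removeNode.2 ⟨hse, t, ht, rfl⟩)
    · obtain rfl := SignedEdge.eq_empty hse
      simp [hroot, binaryPoint, SignedEdge.sat_empty, hw1]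
  have hsum : ∀ (g : Fin k → ℝ) (i : H.traces v),
      ∑ ω with c ω ≤ i, g ω = ∑ ω, g ω * binaryPoint (X ω) (.edge i.1) := by
    intro g i
    rw [Finset.sum_filter]
    refine Finset.sum_congr rfl fun ω _ => ?_
    simp only [binaryPoint, hc ω i, mul_ite, mul_one, mul_zero]
  obtain ⟨q, hq, hqa⟩ := exists_split_of_tree (traces_chain hv) c w hw
    (fun i => y (H.lift v 1 i)) (fun i => y (H.lift v (-1) i))
    (fun i => by rw [hadd, hsum, hXtrace]) (hsup 1) (hsup (-1))
  simp only [hsum] at hqa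
  -- The value at `v` is `1` with conditional probability `q`, and `0` otherwise.
  have hy_eq : (fun i => y (H.varName i)) = ∑ ω, w ω •
      (q ω • (fun i => binaryPoint (insert v (X ω)) (H.varName i)) +
        (1 - q ω) • fun i => binaryPoint (X ω \ {v}) (H.varName i)) := by
    funext i
    rw [Finset.sum_apply]
    simp only [Pi.smul_apply, Pi.add_apply, smul_eq_mul]
    -- Coordinates that do not depend on the value at `v` are already correct.
    have hsame : ∀ n : VarName α, y n = ∑ ω, w ω * binaryPoint (X ω) n →
        (∀ ω, binaryPoint (insert v (X ω)) n = binaryPoint (X ω) n) →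
        (∀ ω, binaryPoint (X ω \ {v}) n = binaryPoint (X ω) n) →
        y n = ∑ ω, w ω * (q ω * binaryPoint (insert v (X ω)) n +
          (1 - q ω) * binaryPoint (X ω \ {v}) n) := by
      intro n hn h1 h0
      rw [hn]
      refine Finset.sum_congr rfl fun ω _ => ?_
      rw [h1, h0]
      ring
    rcases i with ⟨u, hu⟩ | ⟨s, hs⟩
    · by_cases huv : u = v
      · subst huv
        have h := hqa ⟨_, H.empty_mem_traces u⟩
        simp only [binaryPoint, SignedEdge.sat_empty, if_true, mul_one] at h
        simp [varName, binaryPoint, ← hnode, ← h]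
      · exact hsame _ (hXnode u hu huv) (fun ω => by simp [binaryPoint, varName, huv])
          fun ω => by simp [binaryPoint, varName, huv]
    · by_cases hvs : v ∈ s.edge
      · obtain ⟨ε, hε⟩ := (s.mem_edge_iff v).1 hvs
        have ht := remove_mem_traces hs hvs
        have hname : H.varName (Sum.inr ⟨s, hs⟩) = H.lift v ε ⟨_, ht⟩ := by
          simp [varName, lift, SignedEdge.insertNode_remove hε]
        have h1 : ∀ ω, (s.remove v).Sat (insert v (X ω)) ↔ (s.remove v).Sat (X ω) := fun ω =>
          SignedEdge.sat_congr fun u hu => by simp [(Finset.mem_erase.1 hu).1]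
        have h0 : ∀ ω, (s.remove v).Sat (X ω \ {v}) ↔ (s.remove v).Sat (X ω) := fun ω =>
          SignedEdge.sat_congr fun u hu => by simp [(Finset.mem_erase.1 hu).1]
        rw [hname]
        simp only [binaryPoint_lift, h1, h0]
        rcases Int.units_eq_one_or ε with rfl | rfl
        · rw [← hqa]
          refine Finset.sum_congr rfl fun ω _ => ?_
          simp [binaryPoint]
        · have hb : y (H.lift v (-1) ⟨_, ht⟩) = y (.edge (s.remove v)) - y (H.lift v 1 ⟨_, ht⟩) :=
            eq_sub_of_add_eq' (hadd ⟨_, ht⟩)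
          rw [hb, hXtrace ⟨_, ht⟩, ← hqa, ← Finset.sum_sub_distrib]
          refine Finset.sum_congr rfl fun ω _ => ?_
          simp [binaryPoint]
          split_ifs <;> ring
      · have hmem : s ∈ (H.removeNode v).S :=
          mem_S_removeNode.2 ⟨H.edge_nonempty s hs, s, hs, SignedEdge.remove_eq_self hvs⟩
        have hne : ∀ u ∈ s.edge, u ≠ v := fun u hu h => hvs (h ▸ hu)
        exact hsame _ (hXedge s hmem)
          (fun ω => if_congr (SignedEdge.sat_congr fun u hu => by simp [hne u hu]) rfl rfl)
          fun ω => if_congr (SignedEdge.sat_congr fun u hu => by simp [hne u hu]) rfl rfl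
  rw [hy_eq]
  have hconv : Convex ℝ H.pbp := convex_convexHull ℝ _
  exact hconv.sum_mem (fun ω _ => hw ω) hw1 fun ω _ =>
    hconv (H.binaryPoint_mem_pbp _) (H.binaryPoint_mem_pbp _) (hq ω).1 (sub_nonneg.2 (hq ω).2)
      (by ring)

/-! ### Removal of a sequence of beta-leaves -/

/-- The systems of the single beta-leaves of a sequence, taken together. -/
theorem exists_leafSeqSystem (vs : List α) : ∀ H : SignedHypergraph α,
    H.underlying.IsBetaLeafSeq vs → ∃ Q : LinearSystem (VarName α),
      Q.ineqs.card ≤ vs.length * (4 * H.S.card + 8) ∧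
      Q.vars.card ≤ vs.length * (3 * H.S.card + 4) ∧
      Q.HasSignData ∧ (∀ x, binaryPoint x ∈ Q.solutions) ∧
      ∀ y ∈ Q.solutions, (fun i => y ((H.removeNodes vs).varName i)) ∈ (H.removeNodes vs).pbp →
        (fun i => y (H.varName i)) ∈ H.pbp := by
  induction vs with
  | nil =>
    intro H _
    exact ⟨⟨∅⟩, by simp, by simp [LinearSystem.vars], fun c hc => absurd hc (Finset.notMem_empty c),
      fun x c hc => absurd hc (Finset.notMem_empty c), fun y _ h => h⟩
  | cons v vs ih =>
    rintro H ⟨hv, hvs⟩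
    obtain ⟨Q, h1, h2, h3, h4, h5⟩ := ih (H.removeNode v) (H.underlying_removeNode v ▸ hvs)
    have hS := H.card_S_removeNode_le v
    refine ⟨(H.leafSystem v).juxtapose Q, ?_, ?_, (H.leafSystem_hasSignData v).juxtapose h3,
      fun x => LinearSystem.mem_solutions_juxtapose.2
        ⟨binaryPoint_mem_leafSystem_solutions hv x, h4 x⟩, fun y hy h => ?_⟩
    · refine (LinearSystem.card_ineqs_juxtapose_le _ _).trans
        ((add_le_add (H.card_leafSystem_ineqs_le v) h1).trans ?_)
      have h : vs.length * (4 * (H.removeNode v).S.card + 8) ≤ vs.length * (4 * H.S.card + 8) := by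
        gcongr
      rw [List.length_cons, add_one_mul]
      linarith
    · refine (LinearSystem.card_vars_juxtapose_le _ _).trans
        ((add_le_add (H.card_leafSystem_vars_le v) h2).trans ?_)
      have h : vs.length * (3 * (H.removeNode v).S.card + 4) ≤ vs.length * (3 * H.S.card + 4) := by
        gcongr
      rw [List.length_cons, add_one_mul]
      linarith
    · obtain ⟨hy1, hy2⟩ := LinearSystem.mem_solutions_juxtapose.1 hy
      exact mem_pbp_of_mem_leafSystem_solutions hv hy1 (h5 y hy2 h)

/-- If all binary points satisfy `Q`, and `Q` lifts points of the polytope of `H'` to that of `H`,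
then `Q` extends every description of the former polytope to one of the latter. -/
theorem isExtendedFormulation_juxtapose {H H' : SignedHypergraph α} {Q D : LinearSystem (VarName α)}
    (hQ : ∀ x, binaryPoint x ∈ Q.solutions)
    (hlift : ∀ y ∈ Q.solutions, (fun i => y (H'.varName i)) ∈ H'.pbp →
      (fun i => y (H.varName i)) ∈ H.pbp)
    (hD : D.IsExtendedFormulation H'.varName H'.pbp)
    (hvars : ∀ x ∈ D.vars, x ∈ Q.vars ∨ x ∈ Set.range H.varName → x ∈ Set.range H'.varName) :
    (Q.juxtapose D).IsExtendedFormulation H.varName H.pbp := by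
  classical
  have hD' : H'.pbp = _ := hD
  refine Set.Subset.antisymm (convexHull_min ?_ ?_) ?_
  · rw [H.pbs_eq_range]
    rintro _ ⟨x, rfl⟩
    -- Variables of `D` take their values from a solution of `D` over `x`; where they are also variables
    -- of `Q` or coordinates of `H`, they are coordinates of `H'` and so agree with `binaryPoint x`.
    obtain ⟨z, hz, hzx⟩ := hD' ▸ H'.binaryPoint_mem_pbp x
    have hval : ∀ n, n ∈ Q.vars ∨ n ∈ Set.range H.varName →
        (if n ∈ D.vars then z n else binaryPoint x n) = binaryPoint x n := by
      intro n hn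
      split_ifs with hnD
      · obtain ⟨i, rfl⟩ := hvars n hnD hn
        exact congrFun hzx i
      · rfl
    refine ⟨fun n => if n ∈ D.vars then z n else binaryPoint x n,
      LinearSystem.mem_solutions_juxtapose.2 ⟨?_, ?_⟩, funext fun i => hval _ (Or.inr ⟨i, rfl⟩)⟩
    · exact Q.mem_solutions_congr (fun n hn => hval n (Or.inl hn)) (hQ x)
    · exact D.mem_solutions_congr (fun n hn => if_pos hn) hz
  · exact (LinearSystem.convex_solutions _).is_linear_image
      ⟨fun _ _ => rfl, fun _ _ => rfl⟩
  · rintro _ ⟨y, hy, rfl⟩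
    obtain ⟨hyQ, hyD⟩ := LinearSystem.mem_solutions_juxtapose.1 hy
    exact hlift y hyQ (hD' ▸ ⟨y, hyD, rfl⟩)

end SignedHypergraph

theorem mainTheorem7 {α : Type*} (H : SignedHypergraph α)
    (hcard : ∀ s ∈ H.S, 2 ≤ s.edge.card) (hne : H.S.Nonempty)
    (vs : List α) (hlen : 1 ≤ vs.length) (hleaf : H.underlying.IsBetaLeafSeq vs) :
    ∃ Q : LinearSystem (VarName α),
      Q.ineqs.card ≤ 4 * H.rank * vs.length * (2 * H.S.card + 1) ∧
      Q.vars.card ≤ 2 * H.rank * vs.length * (2 * H.S.card + 1) ∧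
      Q.HasSignData ∧
      ∀ D : LinearSystem (VarName α),
        D.IsExtendedFormulation (H.removeNodes vs).varName (H.removeNodes vs).pbp →
        (∀ x ∈ D.vars, x ∈ Q.vars ∨ x ∈ Set.range H.varName →
          x ∈ Set.range (H.removeNodes vs).varName) →
        (Q.juxtapose D).IsExtendedFormulation H.varName H.pbp := by
  obtain ⟨Q, h1, h2, h3, h4, h5⟩ := SignedHypergraph.exists_leafSeqSystem vs H hleaf
  have hr : 2 ≤ H.rank := by
    obtain ⟨s, hs⟩ := hne
    exact (hcard s hs).trans (Finset.le_sup (f := fun s => s.edge.card) hs)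
  refine ⟨Q, h1.trans ?_, h2.trans ?_, h3, fun D hD hvars =>
    SignedHypergraph.isExtendedFormulation_juxtapose h4 h5 hD hvars⟩
  · calc vs.length * (4 * H.S.card + 8) ≤ vs.length * (4 * 2 * (2 * H.S.card + 1)) := by
          gcongr
          omega
      _ = 4 * 2 * vs.length * (2 * H.S.card + 1) := by ring
      _ ≤ _ := by gcongr
  · calc vs.length * (3 * H.S.card + 4) ≤ vs.length * (2 * 2 * (2 * H.S.card + 1)) := by
          gcongr
          omega
      _ = 2 * 2 * vs.length * (2 * H.S.card + 1) := by ring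
      _ ≤ _ := by gcongr
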